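/- An alphabet is a finite nonempty set $\Sigma$. A language $L\subseteq\Sigma^*$ is *definite* if there is $k\ge 0$ such that $xy\in L\Leftrightarrow y\in L$ for all $x\in\Sigma^*$, $y\in\Sigma^k$; it is *generalized definite* if there is $k\ge 0$ such that $x_1yx_2\in L\Leftrightarrow x_1x_2\in L$ for all $x_1,x_2\in\Sigma^k$, $y\in\Sigma^*$. The syntactic semigroup of $L$ is the quotient of $\Sigma^+$ by the congruence $u\sim v\iff(\forall x,y\in\Sigma^*:\ xuy\in L\Leftrightarrow xvy\in L)$. For a class $\mathcal C$ of regular languages (over arbitrary alphabets), the *syntactic complexity* of $\mathcal C$ is the function $f_{\mathcal C}$ such that, for $n\ge 1$, $f_{\mathcal C}(n)$ is the maximal size of the syntactic semigroup of a language in $\mathcal C$ whose minimal complete deterministic automaton has at most $n$ states. **Theorem.** The syntactic complexity of the class of definite languages and that of the class of generalized definite languages coincide: for every $n\ge 1$ both maxima exist and $f_{\mathrm{def}}(n)=f_{\mathrm{gendef}}(n)$. -/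

import Mathlib

/-- The word (list of letters) underlying an element of the free semigroup `Σ⁺`. -/
def FreeSemigroup.word {α : Type*} (u : FreeSemigroup α) : List α := u.head :: u.tail

theorem FreeSemigroup.word_mul {α : Type*} (u v : FreeSemigroup α) :
    (u * v).word = u.word ++ v.word := rfl

namespace Language

variable {α : Type*}

/-- `L` is definite: for some `k`, membership depends only on the suffix of length `k`. -/
def IsDefinite (L : Language α) : Prop :=
  ∃ k : ℕ, ∀ x y : List α, y.length = k → (x ++ y ∈ L ↔ y ∈ L)

/-- `L` is generalized definite: for some `k`, membership of a word `x₁ y x₂` with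
`|x₁| = |x₂| = k` depends only on `x₁` and `x₂`. -/
def IsGeneralizedDefinite (L : Language α) : Prop :=
  ∃ k : ℕ, ∀ x₁ x₂ y : List α, x₁.length = k → x₂.length = k →
    (x₁ ++ y ++ x₂ ∈ L ↔ x₁ ++ x₂ ∈ L)

/-- The syntactic congruence of `L` on the semigroup `Σ⁺` of nonempty words;
the contexts `x`, `y` are allowed to be empty. -/
def syntacticCon (L : Language α) : Con (FreeSemigroup α) where
  r u v := ∀ x y : List α, x ++ u.word ++ y ∈ L ↔ x ++ v.word ++ y ∈ L
  iseqv :=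
    ⟨fun _ _ _ => Iff.rfl, fun h x y => (h x y).symm, fun h h' x y => (h x y).trans (h' x y)⟩
  mul' := by
    intro u v u' v' h h' x y
    have h₁ := h x (u'.word ++ y)
    have h₂ := h' (x ++ v.word) y
    simp only [FreeSemigroup.word_mul, List.append_assoc] at h₁ h₂ ⊢
    exact h₁.trans h₂

/-- The syntactic semigroup `Σ⁺ / ∼_L`. -/
abbrev SyntacticSemigroup (L : Language α) : Type _ := (syntacticCon L).Quotient

end Language

namespace DFA

variable {α σ : Type*}

/-- Every state is reachable from the start state. -/
def IsConnected (M : DFA α σ) : Prop :=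
  ∀ q : σ, ∃ u : List α, M.evalFrom M.start u = q

/-- Some word leads exactly one of the states `p`, `q` to an accepting state. -/
def Distinguishable (M : DFA α σ) (p q : σ) : Prop :=
  ∃ u : List α, ¬ (M.evalFrom p u ∈ M.accept ↔ M.evalFrom q u ∈ M.accept)

/-- A reduced automaton: connected, with distinct states pairwise distinguishable.
The reduced automaton of a language is its minimal automaton. -/
def IsReduced (M : DFA α σ) : Prop :=
  M.IsConnected ∧ ∀ p q : σ, p ≠ q → M.Distinguishable p q

/-- The language of a finite automaton has a finite syntactic semigroup
(so that `Nat.card` below is its true size). -/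
theorem finite_syntacticSemigroup [Finite σ] (M : DFA α σ) :
    Finite (Language.SyntacticSemigroup M.accepts) := by
  let g : Language.SyntacticSemigroup M.accepts → (σ → σ) :=
    fun s p => M.evalFrom p s.out.word
  refine Finite.of_injective g fun s t hst => ?_
  rw [← Quotient.out_eq s, ← Quotient.out_eq t]
  refine Quotient.sound fun x y => ?_
  have h := congrFun hst (M.evalFrom M.start x)
  simp only [g] at h
  simp only [DFA.mem_accepts, DFA.eval, DFA.evalFrom_of_append, h]

end DFA

/-- The sizes of the syntactic semigroups of those languages in the class `C` (over arbitrary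
finite nonempty alphabets) whose minimal automaton has at most `n` states. -/
def syntacticSizes (C : ∀ {α : Type}, Language α → Prop) (n : ℕ) : Set ℕ :=
  {m | ∃ (α : Type) (_ : Finite α) (_ : Nonempty α) (σ : Type) (_ : Finite σ) (M : DFA α σ),
    M.IsReduced ∧ Nat.card σ ≤ n ∧ C M.accepts ∧
      Nat.card (Language.SyntacticSemigroup M.accepts) = m}

/-- The syntactic complexity of a class `C` of languages: the function sending `n` to the maximal
size of the syntactic semigroup of a member of `C` whose minimal automaton has at most
`n` states. -/
noncomputable def syntacticComplexity (C : ∀ {α : Type}, Language α → Prop) (n : ℕ) : ℕ :=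
  sSup (syntacticSizes C n)

/-! Definite languages are generalized definite, so only one inequality needs work: a generalized
definite language that is not definite has at most (n-1)! syntactic classes, and some definite
language has at least that many. Upper bound. Let T be the semigroup of maps induced by nonempty
words on the reduced automaton. Pumping shows that a map fixing p and a point reachable from p has
found the same point twice (`IsReduced.eq_of_fixed`); if the language is not definite, some map in T
fixes two distinct states. Call p recurrent if a map in T fixes it. Recurrent orbits are strongly
connected and pairwise equal or disjoint. An orbit of size a admits at most a! restrictions: a
choices of a fixed point, then (a-1)! ways to move the rest upwards in a strict order. Two fixed
points give two disjoint orbits, which improves r! to (r-1)! on the r recurrent states. Transient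
states move strictly upwards under reachability and contribute (n-1)(n-2)⋯r. The product is (n-1)!.
Lower bound. In the automaton `decreasing` the (n-1)! letters act differently. -/

/-! ### Counting restrictions of a family of self-maps -/

section Restrictions

variable {Q : Type*} [DecidableEq Q]

/-- The number of distinct restrictions to `A` of the maps in `F`. -/
def restrictionCount (F : Finset (Q → Q)) (A : Finset Q) : ℕ :=
  (F.image fun f (a : A) => f a).card

theorem card_le_restrictionCount_univ [Fintype Q] (F : Finset (Q → Q)) :
    F.card ≤ restrictionCount F Finset.univ := by
  refine (Finset.card_image_of_injective F fun f g h => ?_).ge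
  funext q
  exact congrFun h ⟨q, Finset.mem_univ q⟩

theorem restrictionCount_union_le (F : Finset (Q → Q)) (A B : Finset Q) :
    restrictionCount F (A ∪ B) ≤ restrictionCount F A * restrictionCount F B := by
  unfold restrictionCount
  rw [← Finset.card_product]
  refine Finset.card_le_card_of_injOn
    (fun φ => (fun a => φ ⟨a, Finset.mem_union_left B a.2⟩,
      fun b => φ ⟨b, Finset.mem_union_right A b.2⟩)) ?_ ?_
  · intro φ hφ
    obtain ⟨f, hf, rfl⟩ := Finset.mem_image.1 (Finset.mem_coe.1 hφ)
    exact Finset.mem_coe.2 (Finset.mem_product.2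
      ⟨Finset.mem_image_of_mem _ hf, Finset.mem_image_of_mem _ hf⟩)
  · intro φ _ ψ _ h
    funext ⟨q, hq⟩
    rcases Finset.mem_union.1 hq with hA | hB
    · exact congrFun (congrArg Prod.fst h) ⟨q, hA⟩
    · exact congrFun (congrArg Prod.snd h) ⟨q, hB⟩

theorem restrictionCount_empty_le (F : Finset (Q → Q)) : restrictionCount F ∅ ≤ 1 :=
  Finset.card_le_one.2 fun _ _ _ _ => Subsingleton.elim _ _

theorem restrictionCount_singleton_le (F : Finset (Q → Q)) (a : Q) (B : Finset Q)
    (h : ∀ f ∈ F, f a ∈ B) : restrictionCount F {a} ≤ B.card := by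
  refine Finset.card_le_card_of_injOn (fun φ => φ ⟨a, Finset.mem_singleton_self a⟩) ?_ ?_
  · intro φ hφ
    obtain ⟨f, hf, rfl⟩ := Finset.mem_image.1 (Finset.mem_coe.1 hφ)
    exact h f hf
  · intro φ _ ψ _ hφψ
    funext ⟨q, hq⟩
    obtain rfl := Finset.mem_singleton.1 hq
    exact hφψ

theorem restrictionCount_biUnion_le {ι : Type*} (s : Finset ι) (F : Finset (Q → Q))
    (G : ι → Finset (Q → Q)) (A : Finset Q) (h : ∀ f ∈ F, ∃ i ∈ s, f ∈ G i) (b : ℕ)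
    (hb : ∀ i ∈ s, restrictionCount (G i) A ≤ b) : restrictionCount F A ≤ s.card * b := by
  classical
  refine (Finset.card_le_card ?_).trans (Finset.card_biUnion_le_card_mul s
    (fun i => (G i).image fun (f : Q → Q) (a : A) => f a) b hb)
  intro φ hφ
  obtain ⟨f, hf, rfl⟩ := Finset.mem_image.1 hφ
  obtain ⟨i, hi, hfi⟩ := h f hf
  exact Finset.mem_biUnion.2 ⟨i, hi, Finset.mem_image_of_mem _ hfi⟩

/-- Maps that move every point of `A` strictly upwards, inside `B`, for some strict order have at
most `(|B| - 1) (|B| - 2) ⋯ (|B| - |A|)` restrictions to `A`. -/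
theorem restrictionCount_le_descFactorial (F : Finset (Q → Q)) (r : Q → Q → Prop)
    (irrefl : ∀ a, ¬ r a a) (trans : ∀ a b c, r a b → r b c → r a c) :
    ∀ A B : Finset Q, A ⊆ B → (∀ f ∈ F, ∀ a ∈ A, r a (f a) ∧ f a ∈ B) →
      restrictionCount F A ≤ (B.card - 1).descFactorial A.card := by
  intro A
  induction hk : A.card generalizing A with
  | zero =>
    intro B _ _
    rw [Finset.card_eq_zero] at hk
    subst hk
    simpa using restrictionCount_empty_le F
  | succ k ih =>
    intro B hAB hF
    have : IsStrictOrder Q r := { irrefl := irrefl, trans := trans }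
    -- A minimal `a` is the image of no other point of `A`, so it can be deleted from `B` as well as
    -- from `A`; `a` itself has `|B| - 1` possible images.
    obtain ⟨a, ha, hmin⟩ : ∃ a ∈ A, ∀ b ∈ A, ¬ r b a := by
      have hne : (A : Set Q).Nonempty := by
        rw [Finset.coe_nonempty, ← Finset.card_pos, hk]
        exact k.succ_pos
      have hwf : (A : Set Q).WellFoundedOn r := A.finite_toSet.wellFoundedOn
      obtain ⟨a, -, ha⟩ := hwf.has_min Set.univ ⟨⟨_, hne.some_mem⟩, trivial⟩
      exact ⟨a, a.2, fun b hb => ha ⟨b, hb⟩ trivial⟩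
    have hcard : (A.erase a).card = k := by rw [Finset.card_erase_of_mem ha, hk]; rfl
    have hBcard : (B.erase a).card = B.card - 1 := Finset.card_erase_of_mem (hAB ha)
    have h₁ : restrictionCount F {a} ≤ B.card - 1 := by
      rw [← hBcard]
      refine restrictionCount_singleton_le F a _ fun f hf => Finset.mem_erase.2 ⟨fun h => ?_, ?_⟩
      · exact irrefl a (by simpa [h] using (hF f hf a ha).1)
      · exact (hF f hf a ha).2
    have h₂ := ih (A.erase a) hcard (B.erase a) (Finset.erase_subset_erase a hAB) (by
      intro f hf b hb
      obtain ⟨-, hbA⟩ := Finset.mem_erase.1 hb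
      obtain ⟨hr, hfB⟩ := hF f hf b hbA
      exact ⟨hr, Finset.mem_erase.2 ⟨fun h => hmin b hbA (h ▸ hr), hfB⟩⟩)
    rw [hBcard] at h₂
    have h₃ := restrictionCount_union_le F {a} (A.erase a)
    rw [← Finset.insert_eq, Finset.insert_erase ha] at h₃
    have hpos : 0 < B.card := Finset.card_pos.2 ⟨a, hAB ha⟩
    calc restrictionCount F A ≤ (B.card - 1) * (B.card - 1 - 1).descFactorial k :=
          h₃.trans (Nat.mul_le_mul h₁ h₂)
      _ = (B.card - 1).descFactorial (k + 1) := by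
          rcases B.card - 1 with _ | m
          · simp
          · rw [Nat.succ_descFactorial_succ]; rfl

end Restrictions

/-- Two nonempty blocks gain one factor over the factorial of the total size; this saving yields
(n-1)! instead of n!. -/
theorem Nat.succ_factorial_mul_succ_factorial_le (a b : ℕ) :
    (a + 1).factorial * (b + 1).factorial ≤ (a + b + 1).factorial := by
  induction a with
  | zero => simp
  | succ a ih =>
    rw [Nat.factorial_succ (a + 1), show a + 1 + b + 1 = (a + b + 1) + 1 by ring,
      Nat.factorial_succ (a + b + 1), mul_assoc]
    exact Nat.mul_le_mul (by omega) ih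

/-! ### Semigroups of self-maps in which no map fixes a point together with a point reachable
from it -/

/-- A family of self-maps closed under composition such that a map fixing both `p` and a point
`g p` reachable from `p` forces `g p = p`. -/
structure IsReachSeparated {Q : Type*} (T : Finset (Q → Q)) : Prop where
  comp_mem : ∀ f ∈ T, ∀ g ∈ T, g ∘ f ∈ T
  eq_of_fixed : ∀ f ∈ T, ∀ g ∈ T, ∀ p, f p = p → f (g p) = g p → g p = p

/-- Eventual periodicity. The exponents are positive because the semigroup need not contain the
identity. -/
theorem exists_iterate_fixed {Q : Type*} [Finite Q] (f : Q → Q) (q : Q) :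
    ∃ j k : ℕ, f^[k + 1] (f^[j + 1] q) = f^[j + 1] q := by
  obtain ⟨a, b, hab, h⟩ := Finite.exists_ne_map_eq_of_infinite fun n : ℕ => f^[n + 1] q
  wlog hlt : a < b generalizing a b
  · exact this b a hab.symm h.symm (by omega)
  refine ⟨a, b - a - 1, ?_⟩
  rw [← Function.iterate_add_apply, show b - a - 1 + 1 + (a + 1) = b + 1 by omega]
  exact h.symm

namespace IsReachSeparated

variable {Q : Type*} {T : Finset (Q → Q)}

theorem iterate_mem (hT : IsReachSeparated T) {f : Q → Q} (hf : f ∈ T) (k : ℕ) :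
    f^[k + 1] ∈ T := by
  induction k with
  | zero => simpa using hf
  | succ k ih =>
    rw [Function.iterate_succ']
    exact hT.comp_mem _ ih _ hf

variable [DecidableEq Q]

/-- Points reachable from `p`. -/
def orbit (T : Finset (Q → Q)) (p : Q) : Finset Q := T.image fun g => g p

theorem mem_orbit {p q : Q} : q ∈ orbit T p ↔ ∃ g ∈ T, g p = q := Finset.mem_image

theorem orbit_closed (hT : IsReachSeparated T) {p q : Q} (hq : q ∈ orbit T p) {f : Q → Q}
    (hf : f ∈ T) : f q ∈ orbit T p := by
  obtain ⟨g, hg, rfl⟩ := mem_orbit.1 hq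
  exact mem_orbit.2 ⟨_, hT.comp_mem g hg f hf, rfl⟩

theorem mem_orbit_trans (hT : IsReachSeparated T) {p q r : Q} (hq : q ∈ orbit T p)
    (hr : r ∈ orbit T q) : r ∈ orbit T p := by
  obtain ⟨g, hg, rfl⟩ := mem_orbit.1 hr
  exact hT.orbit_closed hq hg

variable [Fintype Q]

/-- If `f` fixes `p`, iterating `f` from `q` ends in a cycle; a power of `f` fixes both `p` and a
point of that cycle, which is reachable from `p` and hence equals `p`. -/
theorem orbit_symm (hT : IsReachSeparated T) {p q : Q} (hp : p ∈ orbit T p)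
    (hq : q ∈ orbit T p) : p ∈ orbit T q := by
  obtain ⟨f, hf, hfp⟩ := mem_orbit.1 hp
  obtain ⟨g, hg, rfl⟩ := mem_orbit.1 hq
  obtain ⟨j, k, h⟩ := exists_iterate_fixed f (g p)
  exact mem_orbit.2 ⟨_, hT.iterate_mem hf j,
    hT.eq_of_fixed _ (hT.iterate_mem hf k) _ (hT.comp_mem g hg _ (hT.iterate_mem hf j)) p
      (Function.iterate_fixed hfp _) h⟩

/-- Cycles of `f` are trivial: a power of `f` fixing a cycle point also fixes its image under `f`.
-/
theorem exists_fixed_mem_orbit (hT : IsReachSeparated T) (p : Q) {f : Q → Q} (hf : f ∈ T) :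
    ∃ c ∈ orbit T p, f c = c := by
  obtain ⟨j, k, h⟩ := exists_iterate_fixed f p
  refine ⟨f^[j + 1] p, mem_orbit.2 ⟨_, hT.iterate_mem hf j, rfl⟩, ?_⟩
  refine hT.eq_of_fixed _ (hT.iterate_mem hf k) f hf _ h ?_
  rw [← Function.iterate_succ_apply, Function.iterate_succ_apply', h]

theorem restrictionCount_orbit_le (hT : IsReachSeparated T) {p : Q} (hp : p ∈ orbit T p) :
    restrictionCount T (orbit T p) ≤ (orbit T p).card.factorial := by
  have hpos : 0 < (orbit T p).card := Finset.card_pos.2 ⟨p, hp⟩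
  rw [← Nat.mul_factorial_pred hpos.ne']
  refine restrictionCount_biUnion_le (orbit T p) T (fun c => T.filter fun f => f c = c) _
    (fun f hf => ?_) _ fun c hc => ?_
  · obtain ⟨c, hc, hfc⟩ := hT.exists_fixed_mem_orbit p hf
    exact ⟨c, hc, Finset.mem_filter.2 ⟨hf, hfc⟩⟩
  · set F := T.filter fun f => f c = c
    have h₁ : restrictionCount F {c} ≤ 1 :=
      restrictionCount_singleton_le F c {c} fun f hf =>
        Finset.mem_singleton.2 (Finset.mem_filter.1 hf).2
    have h₂ := restrictionCount_le_descFactorial F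
      -- Reachability through maps fixing `c`. It is irreflexive because every `a` in the orbit is
      -- reachable from `c`, so no such map fixes an `a ≠ c`.
      (fun a b => (a ∈ orbit T p ∧ a ≠ c) ∧ ∃ g ∈ F, g a = b)
      (by
        rintro a ⟨⟨ha, hac⟩, g, hg, hga⟩
        obtain ⟨hgT, hgc⟩ := Finset.mem_filter.1 hg
        obtain ⟨h, hh, rfl⟩ :=
          mem_orbit.1 (hT.mem_orbit_trans (hT.orbit_symm hp hc) ha)
        exact hac (hT.eq_of_fixed g hgT h hh c hgc hga))
      (by
        rintro a _ _ ⟨ha, g, hg, rfl⟩ ⟨-, h, hh, rfl⟩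
        obtain ⟨hgT, hgc⟩ := Finset.mem_filter.1 hg
        obtain ⟨hhT, hhc⟩ := Finset.mem_filter.1 hh
        exact ⟨ha, h ∘ g, Finset.mem_filter.2 ⟨hT.comp_mem g hgT h hhT, by simp [hgc, hhc]⟩, rfl⟩)
      ((orbit T p).erase c) (orbit T p) (Finset.erase_subset _ _) (by
        intro f hf a ha
        obtain ⟨hac, ha⟩ := Finset.mem_erase.1 ha
        exact ⟨⟨⟨ha, hac⟩, f, hf, rfl⟩, hT.orbit_closed ha (Finset.mem_filter.1 hf).1⟩)
    rw [Finset.card_erase_of_mem hc, Nat.descFactorial_self] at h₂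
    have h₃ := restrictionCount_union_le F {c} ((orbit T p).erase c)
    rw [← Finset.insert_eq, Finset.insert_erase hc] at h₃
    exact h₃.trans ((Nat.mul_le_mul h₁ h₂).trans (one_mul _).le)

/-- A union of recurrent orbits contributes at most the factorial of its size. -/
theorem restrictionCount_recurrent_le (hT : IsReachSeparated T) (X : Finset Q) :
    (∀ p ∈ X, p ∈ orbit T p) → (∀ p ∈ X, orbit T p ⊆ X) →
      restrictionCount T X ≤ X.card.factorial := by
  induction X using Finset.strongInduction with
  | H X ih =>
    intro hrec hcl
    rcases X.eq_empty_or_nonempty with rfl | ⟨p, hpX⟩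
    · simpa using restrictionCount_empty_le T
    have hp := hrec p hpX
    have hsub := hcl p hpX
    have h₁ := hT.restrictionCount_orbit_le hp
    have h₂ := ih (X \ orbit T p)
      (Finset.sdiff_ssubset hsub ⟨p, hp⟩)
      (fun q hq => hrec q (Finset.mem_sdiff.1 hq).1)
      -- By symmetry of reachability, an orbit starting outside `orbit T p` never enters it.
      (fun q hq r hr => Finset.mem_sdiff.2 ⟨hcl q (Finset.mem_sdiff.1 hq).1 hr, fun hrp =>
        (Finset.mem_sdiff.1 hq).2 (hT.mem_orbit_trans hrp
          (hT.orbit_symm (hrec q (Finset.mem_sdiff.1 hq).1) hr))⟩)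
    have h₃ := restrictionCount_union_le T (orbit T p) (X \ orbit T p)
    rw [Finset.union_sdiff_of_subset hsub] at h₃
    refine h₃.trans ((Nat.mul_le_mul h₁ h₂).trans (Nat.le_of_dvd (Nat.factorial_pos _) ?_))
    rw [← Finset.card_sdiff_add_card_eq_card hsub, add_comm]
    exact Nat.factorial_mul_factorial_dvd_factorial_add _ _

/-- Reachability from transient points is a strict order. -/
theorem restrictionCount_transient_le (hT : IsReachSeparated T) (X : Finset Q)
    (hX : ∀ p ∈ X, p ∉ orbit T p) :
    restrictionCount T X ≤ (Fintype.card Q - 1).descFactorial X.card := by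
  refine restrictionCount_le_descFactorial T (fun a b => a ∉ orbit T a ∧ b ∈ orbit T a)
    (fun a h => h.1 h.2) (fun a b c h h' => ⟨h.1, hT.mem_orbit_trans h.2 h'.2⟩) X Finset.univ
    (Finset.subset_univ X) fun f hf a ha => ⟨⟨hX a ha, mem_orbit.2 ⟨f, hf, rfl⟩⟩, ?_⟩
  exact Finset.mem_univ _

/-- If some map of the semigroup has two fixed points, there are at least two recurrent orbits
and the semigroup has at most `(|Q| - 1)!` elements. -/
theorem card_le_factorial (hT : IsReachSeparated T) {f : Q → Q} (hf : f ∈ T) {p q : Q}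
    (hpq : p ≠ q) (hp : f p = p) (hq : f q = q) :
    T.card ≤ (Fintype.card Q - 1).factorial := by
  have hpp : p ∈ orbit T p := mem_orbit.2 ⟨f, hf, hp⟩
  have hqq : q ∈ orbit T q := mem_orbit.2 ⟨f, hf, hq⟩
  have hqp : q ∉ orbit T p := by
    intro h
    obtain ⟨g, hg, rfl⟩ := mem_orbit.1 h
    exact hpq (hT.eq_of_fixed f hf g hg p hp hq).symm
  set R := Finset.univ.filter fun a => a ∈ orbit T a with hR
  have hmemR : ∀ a, a ∈ R ↔ a ∈ orbit T a := fun a => by simp [hR]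
  have hclR : ∀ a ∈ R, orbit T a ⊆ R := fun a ha b hb => (hmemR b).2
    (hT.mem_orbit_trans (hT.orbit_symm ((hmemR a).1 ha) hb) hb)
  have hsub : orbit T p ⊆ R := hclR p ((hmemR p).2 hpp)
  have h₁ := hT.restrictionCount_orbit_le hpp
  have h₂ := hT.restrictionCount_recurrent_le (R \ orbit T p)
    (fun a ha => (hmemR a).1 (Finset.mem_sdiff.1 ha).1)
    (fun a ha b hb => Finset.mem_sdiff.2 ⟨hclR a (Finset.mem_sdiff.1 ha).1 hb, fun hbp =>
      (Finset.mem_sdiff.1 ha).2 (hT.mem_orbit_trans hbp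
        (hT.orbit_symm ((hmemR a).1 (Finset.mem_sdiff.1 ha).1) hb))⟩)
  have h₃ := restrictionCount_union_le T (orbit T p) (R \ orbit T p)
  rw [Finset.union_sdiff_of_subset hsub] at h₃
  have hRle : restrictionCount T R ≤ (R.card - 1).factorial := by
    refine h₃.trans ((Nat.mul_le_mul h₁ h₂).trans ?_)
    obtain ⟨a, ha⟩ := Nat.exists_eq_add_one.2 (Finset.card_pos.2 ⟨p, hpp⟩)
    obtain ⟨b, hb⟩ := Nat.exists_eq_add_one.2 (Finset.card_pos.2
      ⟨q, Finset.mem_sdiff.2 ⟨(hmemR q).2 hqq, hqp⟩⟩)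
    rw [← Finset.card_sdiff_add_card_eq_card hsub, ha, hb,
      show b + 1 + (a + 1) - 1 = a + b + 1 by omega]
    exact Nat.succ_factorial_mul_succ_factorial_le a b
  have h₄ := hT.restrictionCount_transient_le Rᶜ
    fun a ha => fun h => Finset.mem_compl.1 ha ((hmemR a).2 h)
  have h₅ := restrictionCount_union_le T R Rᶜ
  rw [Finset.union_compl] at h₅
  refine (card_le_restrictionCount_univ T).trans (h₅.trans ((Nat.mul_le_mul hRle h₄).trans ?_))
  have hRpos : 0 < R.card := Finset.card_pos.2 ⟨p, (hmemR p).2 hpp⟩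
  have hRn : R.card ≤ Fintype.card Q := Finset.card_le_univ R
  have hc : Rᶜ.card ≤ Fintype.card Q - 1 := by rw [Finset.card_compl]; omega
  rw [← Nat.factorial_mul_descFactorial hc, Finset.card_compl,
    show Fintype.card Q - 1 - (Fintype.card Q - R.card) = R.card - 1 by omega]

end IsReachSeparated

/-! ### Reduced automata -/

namespace Language

variable {α : Type*} {L : Language α}

theorem IsDefinite.isGeneralizedDefinite (h : L.IsDefinite) : L.IsGeneralizedDefinite := by
  obtain ⟨k, hk⟩ := h
  exact ⟨k, fun x₁ x₂ y _ h₂ => (hk (x₁ ++ y) x₂ h₂).trans (hk x₁ x₂ h₂).symm⟩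

/-- In a generalized definite language, a factor between two long words can be erased. -/
theorem IsGeneralizedDefinite.exists_erase (h : L.IsGeneralizedDefinite) :
    ∃ k : ℕ, ∀ u v y : List α, k ≤ u.length → k ≤ v.length →
      (u ++ y ++ v ∈ L ↔ u ++ v ∈ L) := by
  obtain ⟨k, hk⟩ := h
  refine ⟨k, fun u v y hu hv => ?_⟩
  have key : ∀ z : List α, u ++ z ++ v ∈ L ↔ u.take k ++ v.drop (v.length - k) ∈ L := by
    intro z
    rw [← hk (u.take k) (v.drop (v.length - k))
      (u.drop k ++ z ++ v.take (v.length - k)) (by simp [hu]) (by simp; omega)]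
    have e : u.take k ++ (u.drop k ++ z ++ v.take (v.length - k)) ++ v.drop (v.length - k) =
        (u.take k ++ u.drop k) ++ z ++ (v.take (v.length - k) ++ v.drop (v.length - k)) := by
      simp only [List.append_assoc]
    rw [e, List.take_append_drop, List.take_append_drop]
  rw [key y, ← key [], List.append_nil]

end Language

theorem FreeSemigroup.exists_word_eq {α : Type*} {w : List α} (hw : w ≠ []) :
    ∃ u : FreeSemigroup α, u.word = w := by
  cases w with
  | nil => exact absurd rfl hw
  | cons a w => exact ⟨⟨a, w⟩, rfl⟩

theorem FreeSemigroup.word_ne_nil {α : Type*} (u : FreeSemigroup α) : u.word ≠ [] :=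
  List.cons_ne_nil _ _

namespace DFA

variable {α σ : Type*} (M : DFA α σ)

theorem evalFrom_flatten_replicate {p : σ} {x : List α} (h : M.evalFrom p x = p) (k : ℕ) :
    M.evalFrom p (List.replicate k x).flatten = p := by
  induction k with
  | zero => rfl
  | succ k ih => rw [List.replicate_succ, List.flatten_cons, evalFrom_of_append, h, ih]

variable {M}

theorem IsReduced.eq_of_forall (hM : M.IsReduced) {p q : σ}
    (h : ∀ z, M.evalFrom p z ∈ M.accept ↔ M.evalFrom q z ∈ M.accept) : p = q := by
  by_contra hpq
  obtain ⟨z, hz⟩ := hM.2 p q hpq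
  exact hz (h z)

theorem IsReduced.evalFrom_eq_of_syntacticCon (hM : M.IsReduced) {u v : FreeSemigroup α}
    (h : M.accepts.syntacticCon u v) (q : σ) : M.evalFrom q u.word = M.evalFrom q v.word := by
  obtain ⟨w, rfl⟩ := hM.1 q
  refine hM.eq_of_forall fun z => ?_
  simpa only [DFA.mem_accepts, DFA.eval, evalFrom_of_append] using h w z

/-- For `w` leading to `p`, pad `w` and `z` with many copies of `x`, which moves neither state. The
factor `y` then sits between long words and can be erased, so no `z` separates the two states. -/
theorem IsReduced.eq_of_fixed (hM : M.IsReduced) (hL : M.accepts.IsGeneralizedDefinite)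
    {x y : List α} (hx : x ≠ []) {p : σ} (hp : M.evalFrom p x = p)
    (hq : M.evalFrom (M.evalFrom p y) x = M.evalFrom p y) : M.evalFrom p y = p := by
  obtain ⟨k, hk⟩ := hL.exists_erase
  obtain ⟨w, rfl⟩ := hM.1 p
  refine hM.eq_of_forall fun z => ?_
  have hlen : k ≤ (List.replicate k x).flatten.length := by
    have : 0 < x.length := List.length_pos_iff.2 hx
    simp only [List.length_flatten, List.map_replicate, List.sum_replicate, smul_eq_mul]
    exact Nat.le_mul_of_pos_right k this
  have h := hk (w ++ (List.replicate k x).flatten) ((List.replicate k x).flatten ++ z) y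
    (by rw [List.length_append]; omega) (by rw [List.length_append]; omega)
  simpa only [DFA.mem_accepts, DFA.eval, evalFrom_of_append, evalFrom_flatten_replicate M hp,
    evalFrom_flatten_replicate M hq] using h

/-- If no nonempty word fixes two states, then every sufficiently long word is constant. -/
theorem isDefinite_accepts_of_fixed_eq [Finite σ]
    (h : ∀ x : List α, x ≠ [] → ∀ p q, M.evalFrom p x = p → M.evalFrom q x = q → p = q) :
    M.accepts.IsDefinite := by
  have := Fintype.ofFinite σ
  -- Pigeonhole on pairs of states along the prefixes of `y`: a repeated pair gives a nonempty
  -- factor fixing both components, which must then agree.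
  have key : ∀ (y : List α), y.length = Fintype.card (σ × σ) → ∀ p q,
      M.evalFrom p y = M.evalFrom q y := by
    intro y hy p q
    obtain ⟨i, j, hij, he⟩ := Fintype.exists_ne_map_eq_of_card_lt
      (fun i : Fin (y.length + 1) => (M.evalFrom p (y.take i), M.evalFrom q (y.take i)))
      (by simp [hy])
    wlog hlt : i < j generalizing i j
    · exact this j i hij.symm he.symm (lt_of_le_of_ne (not_lt.1 hlt) hij.symm)
    have hsplit : y.take j = y.take i ++ (y.take j).drop i := by
      conv_lhs => rw [← List.take_append_drop i (y.take j), List.take_take,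
        min_eq_left (Fin.le_def.1 hlt.le)]
    obtain ⟨hp, hq⟩ := Prod.mk.inj he
    have heq : M.evalFrom p (y.take i) = M.evalFrom q (y.take i) := by
      refine h ((y.take j).drop i) ?_ _ _ ?_ ?_
      · rw [← List.length_pos_iff]
        have := j.2
        have : (i : ℕ) < j := hlt
        simp only [List.length_drop, List.length_take]
        omega
      · rw [← evalFrom_of_append, ← hsplit, hp]
      · rw [← evalFrom_of_append, ← hsplit, hq]
    rw [← List.take_append_drop i y, evalFrom_of_append, evalFrom_of_append, heq]
  refine ⟨Fintype.card (σ × σ), fun x y hy => ?_⟩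
  simp only [DFA.mem_accepts, DFA.eval, evalFrom_of_append]
  rw [key y hy]

variable (M)

open Classical in
/-- The transformations of the states induced by nonempty words. -/
noncomputable def transitionMaps [Fintype σ] : Finset (σ → σ) :=
  Finset.univ.filter fun f => ∃ u : FreeSemigroup α, f = fun p => M.evalFrom p u.word

variable {M}

theorem mem_transitionMaps [Fintype σ] {f : σ → σ} :
    f ∈ M.transitionMaps ↔ ∃ u : FreeSemigroup α, f = fun p => M.evalFrom p u.word := by
  simp [transitionMaps]

theorem card_syntacticSemigroup_le [Fintype σ] :
    Nat.card (Language.SyntacticSemigroup M.accepts) ≤ M.transitionMaps.card := by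
  let g : Language.SyntacticSemigroup M.accepts → M.transitionMaps := fun s =>
    ⟨fun p => M.evalFrom p s.out.word, mem_transitionMaps.2 ⟨s.out, rfl⟩⟩
  have hg : Function.Injective g := by
    intro s t hst
    rw [← Quotient.out_eq s, ← Quotient.out_eq t]
    refine Quotient.sound fun x y => ?_
    have h := congrFun (Subtype.ext_iff.1 hst) (M.evalFrom M.start x)
    simp only [g] at h
    simp only [DFA.mem_accepts, DFA.eval, DFA.evalFrom_of_append, h]
  simpa using Nat.card_le_card_of_injective g hg

theorem IsReduced.isReachSeparated [Fintype σ] (hM : M.IsReduced)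
    (hL : M.accepts.IsGeneralizedDefinite) : IsReachSeparated M.transitionMaps where
  comp_mem := by
    intro f hf g hg
    obtain ⟨u, rfl⟩ := mem_transitionMaps.1 hf
    obtain ⟨v, rfl⟩ := mem_transitionMaps.1 hg
    refine mem_transitionMaps.2 ⟨u * v, funext fun p => ?_⟩
    rw [FreeSemigroup.word_mul, evalFrom_of_append]
    rfl
  eq_of_fixed := by
    intro f hf g hg p hp hq
    obtain ⟨u, rfl⟩ := mem_transitionMaps.1 hf
    obtain ⟨v, rfl⟩ := mem_transitionMaps.1 hg
    exact hM.eq_of_fixed hL u.word_ne_nil hp hq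

/-- A reduced automaton of a generalized definite language that is not definite has a small
syntactic semigroup. -/
theorem IsReduced.card_syntacticSemigroup_le_factorial [Finite σ] (hM : M.IsReduced)
    (hL : M.accepts.IsGeneralizedDefinite) (hD : ¬ M.accepts.IsDefinite) :
    Nat.card (Language.SyntacticSemigroup M.accepts) ≤ (Nat.card σ - 1).factorial := by
  classical
  have := Fintype.ofFinite σ
  have hex : ∃ x : List α, x ≠ [] ∧ ∃ p q, M.evalFrom p x = p ∧ M.evalFrom q x = q ∧ p ≠ q := by
    by_contra! hcon
    exact hD (isDefinite_accepts_of_fixed_eq hcon)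
  obtain ⟨x, hx, p, q, hp, hq, hpq⟩ := hex
  obtain ⟨u, rfl⟩ := FreeSemigroup.exists_word_eq hx
  rw [Nat.card_eq_fintype_card (α := σ)]
  exact card_syntacticSemigroup_le.trans
    ((hM.isReachSeparated hL).card_le_factorial (mem_transitionMaps.2 ⟨u, rfl⟩) hpq hp hq)

theorem card_syntacticSemigroup_le_pow [Finite σ] :
    Nat.card (Language.SyntacticSemigroup M.accepts) ≤ Nat.card σ ^ Nat.card σ := by
  classical
  have := Fintype.ofFinite σ
  rw [Nat.card_eq_fintype_card (α := σ), ← Fintype.card_fun]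
  exact card_syntacticSemigroup_le.trans (Finset.card_le_univ _)

/-! ### The automaton of all decreasing maps -/

/-- The automaton on `Fin (m + 1)` whose letters are all the maps fixing `0` and sending every
other state to a smaller one. -/
def decreasing (m : ℕ) : DFA ((i : Fin m) → Fin (i + 1)) (Fin (m + 1)) where
  step q a := Fin.cases 0 (fun i => (a i).castLE (by omega)) q
  start := Fin.last m
  accept := {0}

theorem decreasing_step_zero {m : ℕ} (a : (i : Fin m) → Fin (i + 1)) :
    (decreasing m).step 0 a = 0 := rfl

theorem decreasing_step_succ {m : ℕ} (a : (i : Fin m) → Fin (i + 1)) (i : Fin m) :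
    (decreasing m).step i.succ a = (a i).castLE (by omega) := rfl

theorem decreasing_step_le {m : ℕ} (a : (i : Fin m) → Fin (i + 1)) (q : Fin (m + 1)) :
    ((decreasing m).step q a : ℕ) ≤ q - 1 := by
  cases q using Fin.cases with
  | zero => rw [decreasing_step_zero]; simp
  | succ i =>
    rw [decreasing_step_succ]
    have := (a i).2
    simp only [Fin.val_castLE, Fin.val_succ]
    omega

theorem decreasing_evalFrom_le {m : ℕ} (u : List ((i : Fin m) → Fin (i + 1)))
    (q : Fin (m + 1)) : ((decreasing m).evalFrom q u : ℕ) ≤ q - u.length := by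
  induction u generalizing q with
  | nil => simp
  | cons a u ih =>
    have h₁ := ih ((decreasing m).step q a)
    have h₂ := decreasing_step_le a q
    rw [evalFrom_cons, List.length_cons]
    omega

theorem decreasing_evalFrom_replicate {m : ℕ} (k : ℕ) (q : Fin (m + 1)) :
    ((decreasing m).evalFrom q (List.replicate k fun i => Fin.last i) : ℕ) = q - k := by
  induction k generalizing q with
  | zero => simp
  | succ k ih =>
    rw [List.replicate_succ, evalFrom_cons, ih]
    cases q using Fin.cases with
    | zero => rw [decreasing_step_zero]; simp
    | succ i =>
      rw [decreasing_step_succ]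
      simp only [Fin.val_castLE, Fin.val_succ, Fin.val_last]
      omega

theorem decreasing_isReduced (m : ℕ) : (decreasing m).IsReduced := by
  constructor
  · intro q
    refine ⟨List.replicate (m - q) fun i => Fin.last i, Fin.ext ?_⟩
    rw [decreasing_evalFrom_replicate]
    have : ((decreasing m).start : ℕ) = m := rfl
    omega
  · have key : ∀ p q : Fin (m + 1), p < q → (decreasing m).Distinguishable p q := by
      intro p q hpq
      have hlt : (p : ℕ) < q := hpq
      -- The letter `Fin.last` is the predecessor map; applied `p` times it takes `p` to 0 but
      -- leaves `q` positive.
      refine ⟨List.replicate p fun i => Fin.last i, fun h => ?_⟩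
      have hp : (decreasing m).evalFrom p (List.replicate p fun i => Fin.last i) ∈
          (decreasing m).accept :=
        Fin.ext (by rw [decreasing_evalFrom_replicate]; simp)
      have hq := congrArg Fin.val (h.1 hp : _ = (0 : Fin (m + 1)))
      rw [decreasing_evalFrom_replicate, Fin.val_zero] at hq
      omega
    intro p q hpq
    rcases lt_or_gt_of_ne hpq with h | h
    · exact key p q h
    · obtain ⟨u, hu⟩ := key q p h
      exact ⟨u, fun h' => hu h'.symm⟩

theorem decreasing_isDefinite (m : ℕ) : (decreasing m).accepts.IsDefinite := by
  have key : ∀ (y : List ((i : Fin m) → Fin (i + 1))), m ≤ y.length →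
      y ∈ (decreasing m).accepts := by
    intro y hy
    have h := decreasing_evalFrom_le y (decreasing m).start
    have : ((decreasing m).start : ℕ) = m := rfl
    refine (Fin.ext ?_ : (decreasing m).evalFrom (decreasing m).start y = 0)
    rw [Fin.val_zero]
    omega
  exact ⟨m, fun x y hy => iff_of_true (key _ (by rw [List.length_append]; omega)) (key y hy.ge)⟩

/-- One-letter words suffice: the automaton is reduced, so letters with different actions are not
congruent. -/
theorem factorial_le_card_syntacticSemigroup_decreasing (m : ℕ) :
    m.factorial ≤ Nat.card (Language.SyntacticSemigroup (decreasing m).accepts) := by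
  have := finite_syntacticSemigroup (decreasing m)
  have hcard : Nat.card ((i : Fin m) → Fin (i + 1)) = m.factorial := by
    rw [Nat.card_eq_fintype_card, Fintype.card_pi]
    simp only [Fintype.card_fin]
    rw [Fin.prod_univ_eq_prod_range (fun i => i + 1) m, Finset.prod_range_add_one_eq_factorial]
  rw [← hcard]
  refine Nat.card_le_card_of_injective
    (fun a => (FreeSemigroup.of a : Language.SyntacticSemigroup (decreasing m).accepts))
    fun a b hab => funext fun i => ?_
  have h := (decreasing_isReduced m).evalFrom_eq_of_syntacticCon ((Con.eq _).1 hab) i.succ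
  have h' : (decreasing m).step i.succ a = (decreasing m).step i.succ b := h
  rw [decreasing_step_succ, decreasing_step_succ] at h'
  exact Fin.castLE_injective _ h'

end DFA

/-! ### Syntactic complexity -/

theorem syntacticSizes_bddAbove (C : ∀ {α : Type}, Language α → Prop) {n : ℕ} (hn : 1 ≤ n) :
    BddAbove (syntacticSizes C n) := by
  refine ⟨n ^ n, ?_⟩
  rintro _ ⟨α, _, _, σ, _, M, hM, hσ, -, rfl⟩
  have : Nonempty σ := ⟨M.start⟩
  exact DFA.card_syntacticSemigroup_le_pow.trans
    ((Nat.pow_le_pow_left hσ _).trans (Nat.pow_le_pow_right hn hσ))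

theorem syntacticSizes_zero (C : ∀ {α : Type}, Language α → Prop) : syntacticSizes C 0 = ∅ := by
  refine Set.eq_empty_of_forall_notMem ?_
  rintro _ ⟨α, _, _, σ, _, M, hM, hσ, -, rfl⟩
  have : Nonempty σ := ⟨M.start⟩
  exact absurd hσ (not_le.2 Nat.card_pos)

theorem exists_factorial_le_mem_syntacticSizes {n : ℕ} (hn : 1 ≤ n) :
    ∃ s ∈ syntacticSizes Language.IsDefinite n, (n - 1).factorial ≤ s := by
  obtain ⟨m, rfl⟩ := Nat.exists_eq_add_of_le' hn
  exact ⟨_, ⟨_, inferInstance, inferInstance, _, inferInstance, DFA.decreasing m,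
    DFA.decreasing_isReduced m, by simp, DFA.decreasing_isDefinite m, rfl⟩,
    DFA.factorial_le_card_syntacticSemigroup_decreasing m⟩

theorem syntacticSizes_isDefinite_subset (n : ℕ) :
    syntacticSizes Language.IsDefinite n ⊆ syntacticSizes Language.IsGeneralizedDefinite n := by
  rintro _ ⟨α, hα, hα', σ, hσ, M, hM, hn, hL, rfl⟩
  exact ⟨α, hα, hα', σ, hσ, M, hM, hn, hL.isGeneralizedDefinite, rfl⟩

theorem exists_le_mem_syntacticSizes_isDefinite {n s : ℕ} (hn : 1 ≤ n)
    (hs : s ∈ syntacticSizes Language.IsGeneralizedDefinite n) :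
    ∃ t ∈ syntacticSizes Language.IsDefinite n, s ≤ t := by
  obtain ⟨α, hα, hα', σ, hσ, M, hM, hcard, hL, rfl⟩ := hs
  by_cases hD : M.accepts.IsDefinite
  · exact ⟨_, ⟨α, hα, hα', σ, hσ, M, hM, hcard, hD, rfl⟩, le_rfl⟩
  · obtain ⟨t, ht, hle⟩ := exists_factorial_le_mem_syntacticSizes hn
    exact ⟨t, ht, (hM.card_syntacticSemigroup_le_factorial hL hD).trans
      ((Nat.factorial_le (Nat.sub_le_sub_right hcard 1)).trans hle)⟩

theorem isGreatest_syntacticComplexity (C : ∀ {α : Type}, Language α → Prop) {n : ℕ}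
    (hn : 1 ≤ n) (hne : (syntacticSizes C n).Nonempty) :
    IsGreatest (syntacticSizes C n) (syntacticComplexity C n) :=
  ⟨Nat.sSup_mem hne (syntacticSizes_bddAbove C hn),
    fun _ hs => le_csSup (syntacticSizes_bddAbove C hn) hs⟩

theorem mainTheorem4 :
    syntacticComplexity Language.IsGeneralizedDefinite =
        syntacticComplexity Language.IsDefinite ∧
      ∀ n : ℕ, 1 ≤ n →
        IsGreatest (syntacticSizes Language.IsGeneralizedDefinite n)
            (syntacticComplexity Language.IsGeneralizedDefinite n) ∧
          IsGreatest (syntacticSizes Language.IsDefinite n)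
            (syntacticComplexity Language.IsDefinite n) := by
  have hmax : ∀ n : ℕ, 1 ≤ n →
      IsGreatest (syntacticSizes Language.IsGeneralizedDefinite n)
          (syntacticComplexity Language.IsGeneralizedDefinite n) ∧
        IsGreatest (syntacticSizes Language.IsDefinite n)
          (syntacticComplexity Language.IsDefinite n) := by
    intro n hn
    obtain ⟨s, hs, -⟩ := exists_factorial_le_mem_syntacticSizes hn
    exact ⟨isGreatest_syntacticComplexity _ hn ⟨s, syntacticSizes_isDefinite_subset n hs⟩,
      isGreatest_syntacticComplexity _ hn ⟨s, hs⟩⟩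
  refine ⟨funext fun n => ?_, hmax⟩
  -- No automaton has zero states, so at `n = 0` both sides are `sSup ∅`.
  rcases Nat.eq_zero_or_pos n with rfl | hn
  · simp only [syntacticComplexity, syntacticSizes_zero]
  · obtain ⟨hG, hD⟩ := hmax n hn
    obtain ⟨t, ht, hle⟩ := exists_le_mem_syntacticSizes_isDefinite hn hG.1
    exact le_antisymm (hle.trans (hD.2 ht)) (hG.2 (syntacticSizes_isDefinite_subset n hD.1))
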